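/- Let $K$ be a field, let $A$ be a finite-dimensional $K$-algebra (associative with unit), and let $n\ge 0$ be an integer. A finite-dimensional left $A$-module $T$ is called a tilting module if its projective dimension is at most $1$, $\operatorname{Ext}^1_A(T,T)=0$, and the number of isomorphism classes of indecomposable direct summands of $T$ equals the number of isomorphism classes of simple $A$-modules. Let $X=X_1\oplus\cdots\oplus X_n$ and $Y=Y_1\oplus\cdots\oplus Y_n$ be finite-dimensional tilting $A$-modules, where all $X_i$ and all $Y_i$ are indecomposable, and where both $X$ and $Y$ are multiplicity-free, i.e. $X_i\not\simeq X_j$ and $Y_i\not\simeq Y_j$ for $i\ne j$. Then there is a permutation $s$ of $\{1,\dots,n\}$ such that, for every $i=1,\dots,n$, either $X_i\simeq Y_{s(i)}$, or there is a non-split short exact sequence of $A$-modules $$0\to U\to V\to W\to 0$$ with $\{U,W\}=\{X_i,Y_{s(i)}\}$. -/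

import Mathlib

universe u

section TiltingDefinitions

/-- A module is indecomposable if it is nonzero and is not the internal direct sum of two
nonzero submodules. -/
def IsIndecomposableModule (A : Type u) [Ring A] (M : Type u) [AddCommGroup M] [Module A M] :
    Prop :=
  Nontrivial M ∧ ∀ N N' : Submodule A M, IsCompl N N' → N = ⊥ ∨ N' = ⊥

/-- The indecomposable direct summands of the module `T`, as submodules of `T`. -/
def IndecomposableSummand (A : Type u) [Ring A] (T : Type u) [AddCommGroup T] [Module A T] :
    Type u :=
  {N : Submodule A T // (∃ N' : Submodule A T, IsCompl N N') ∧ IsIndecomposableModule A N}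

/-- Isomorphism of indecomposable direct summands of `T`. -/
def indecomposableSummandSetoid (A : Type u) [Ring A] (T : Type u) [AddCommGroup T]
    [Module A T] : Setoid (IndecomposableSummand A T) where
  r N N' := Nonempty (N.1 ≃ₗ[A] N'.1)
  iseqv :=
    { refl := fun N => ⟨LinearEquiv.refl A N.1⟩
      symm := fun ⟨e⟩ => ⟨e.symm⟩
      trans := fun ⟨e⟩ ⟨e'⟩ => ⟨e.trans e'⟩ }

/-- The number of isomorphism classes of indecomposable direct summands of `T`. -/
noncomputable def numIndecomposableSummands (A : Type u) [Ring A] (T : Type u)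
    [AddCommGroup T] [Module A T] : ℕ∞ :=
  ENat.card (Quotient (indecomposableSummandSetoid A T))

/-- The simple `A`-modules. -/
def SimpleModuleOver (A : Type u) [Ring A] : Type (u + 1) :=
  {S : ModuleCat.{u} A // IsSimpleModule A S}

/-- Isomorphism of simple `A`-modules. -/
def simpleModuleSetoid (A : Type u) [Ring A] : Setoid (SimpleModuleOver A) where
  r S S' := Nonempty (S.1 ≃ₗ[A] S'.1)
  iseqv :=
    { refl := fun S => ⟨LinearEquiv.refl A S.1⟩
      symm := fun ⟨e⟩ => ⟨e.symm⟩
      trans := fun ⟨e⟩ ⟨e'⟩ => ⟨e.trans e'⟩ }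

/-- The number of isomorphism classes of simple `A`-modules. -/
noncomputable def numSimpleModules (A : Type u) [Ring A] : ℕ∞ :=
  ENat.card (Quotient (simpleModuleSetoid A))

/-- The conditions for a finite-dimensional module `T` over a finite-dimensional algebra `A` to be
a (classical) tilting module. -/
structure IsTiltingModule (A : Type u) [Ring A] (T : Type u) [AddCommGroup T] [Module A T] :
    Prop where
  projectiveDimension_le_one : CategoryTheory.HasProjectiveDimensionLE (ModuleCat.of A T) 1
  ext_one_self_eq_zero :
    Subsingleton (CategoryTheory.Abelian.Ext.{u} (ModuleCat.of A T) (ModuleCat.of A T) 1)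
  card_summands_eq : numIndecomposableSummands A T = numSimpleModules A

/-- There is a short exact sequence `0 → U → V → W → 0` of `A`-modules that does not split. -/
def ExistsNonsplitExtension (A : Type u) [Ring A] (U W : Type u) [AddCommGroup U] [Module A U]
    [AddCommGroup W] [Module A W] : Prop :=
  ∃ (V : Type u) (_ : AddCommGroup V) (_ : Module A V) (f : U →ₗ[A] V) (g : V →ₗ[A] W),
    Function.Injective f ∧ Function.Exact f g ∧ Function.Surjective g ∧
      ¬ ∃ r : V →ₗ[A] U, r ∘ₗ f = LinearMap.id

end TiltingDefinitions

/-!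
The argument combines Hall's marriage theorem with the bound on the size of a rigid family.

Relate `X i` to `Y j` if they are isomorphic or if there is a non-split extension between them in
one of the two directions. If `I` is a set of indices and `J` the set of those `j` for which `Y j` is
related to no `X i` with `i ∈ I`, then the modules `X i`, `i ∈ I`, and `Y j`, `j ∈ J`, are pairwise
non-isomorphic indecomposables of projective dimension at most one without extensions between any
two of them. Such a rigid family has at most as many members as there are simple modules
(`card_le_numSimpleModules`), and there are at most `n` simple modules because `X` is tilting
(`numIndecomposableSummands_pi_le`). Hence `|I| + |J| ≤ n`, which is Hall's condition for `I`.

For the bound let `M i` be a rigid family. The Euler form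
`⟨M i, X⟩ = dim Hom(M i, X) - dim Ext¹(M i, X)`, which is computed from a projective presentation
`0 → ker p → P → M i → 0` (`eulerForm`), is additive on short exact sequences in `X` and so
determined by its values on the simple modules. If the family had more members than there are simple modules,
there would be integers `a i`, not all zero, with `∑ a i ⟨M i, X⟩ = 0` for all `X`. Since the
projective dimensions are at most one, `Ext¹(M i, X) = 0` for all quotients `X` of a member. Let
`X` be the quotient of some `M i` with `a i > 0` by the trace of the `M j` with `a j < 0`. There are no
nonzero maps `M j → X` for `a j < 0`, and the relation forces `Hom(M i, X) = 0`, that is, `X = 0`. Thus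
the `M i` with `a i > 0` are generated by the `M j` with `a j < 0`, and conversely
(`familyTrace_eq_top_of_sum_mul_eulerForm_eq_zero`). This is impossible for pairwise non-isomorphic
indecomposables, by the Nakayama lemma for their local endomorphism rings
(`eq_empty_of_forall_familyTrace_diff_eq_top`).
-/

/-! ### Endomorphisms of indecomposable modules -/

section Indecomposable

variable {A : Type u} [Ring A] {M N : Type u} [AddCommGroup M] [Module A M] [AddCommGroup N]
  [Module A N]

/-- Fitting's lemma for an indecomposable module of finite length. -/
theorem IsIndecomposableModule.isUnit_or_isNilpotent [IsNoetherian A M] [IsArtinian A M]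
    (hM : IsIndecomposableModule A M) (f : Module.End A M) : IsUnit f ∨ IsNilpotent f := by
  obtain ⟨m, hm⟩ := Filter.eventually_atTop.1 f.eventually_isCompl_ker_pow_range_pow
  have hc := hm (m + 1) (by omega)
  rcases hM.2 _ _ hc with h | h
  · left
    have hinj : Function.Injective (f ^ (m + 1)) := LinearMap.ker_eq_bot.1 h
    have hsurj : Function.Surjective (f ^ (m + 1)) := by
      rw [← LinearMap.range_eq_top]
      have := hc.sup_eq_top
      rwa [h, bot_sup_eq] at this
    have hu : IsUnit (f ^ (m + 1)) := (Module.End.isUnit_iff _).2 ⟨hinj, hsurj⟩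
    exact (isUnit_pow_iff (by omega)).1 hu
  · right
    exact ⟨m + 1, LinearMap.range_eq_bot.1 h⟩

/-- If the identity of a nonzero module `M` factors up to an automorphism through an indecomposable
module `N`, then `M` is a nonzero direct summand of `N`, hence all of it. -/
theorem IsIndecomposableModule.nonempty_linearEquiv_of_isUnit_comp [Nontrivial M]
    (hN : IsIndecomposableModule A N) (f : M →ₗ[A] N) (g : N →ₗ[A] M)
    (h : IsUnit (g ∘ₗ f : Module.End A M)) : Nonempty (M ≃ₗ[A] N) := by
  have hbij := (Module.End.isUnit_iff _).1 h
  have hf : Function.Injective f := Function.Injective.of_comp (f := g) hbij.1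
  have hc : IsCompl (LinearMap.range f) (LinearMap.ker g) := by
    constructor
    · rw [Submodule.disjoint_def]
      rintro _ ⟨x, rfl⟩ hx
      have : x = 0 := hbij.1 (by simpa using hx)
      simp [this]
    · rw [codisjoint_iff, eq_top_iff]
      rintro y -
      obtain ⟨x, hx⟩ := hbij.2 (g y)
      refine Submodule.mem_sup.2 ⟨f x, ⟨x, rfl⟩, y - f x, ?_, by abel⟩
      simp only [LinearMap.mem_ker, map_sub]
      rw [← hx]; simp
  rcases hN.2 _ _ hc with h0 | h0
  · exfalso
    obtain ⟨x, hx⟩ := exists_ne (0 : M)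
    apply hx
    apply hf
    rw [LinearMap.range_eq_bot.1 h0]; simp
  · have : LinearMap.range f = ⊤ := by simpa [h0] using hc.sup_eq_top
    exact ⟨LinearEquiv.ofBijective f ⟨hf, LinearMap.range_eq_top.1 this⟩⟩

/-- A Nakayama lemma for an indecomposable finite-dimensional module `M`: the images of the
non-invertible endomorphisms, together with any proper subgroup stable under all endomorphisms, lie
in one proper subgroup stable under all endomorphisms. -/
theorem IsIndecomposableModule.exists_ne_top_forall_not_isUnit {K : Type*} [Field K] [Algebra K A]
    [Module K M] [IsScalarTower K A M] [FiniteDimensional K M] (hM : IsIndecomposableModule A M)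
    (Z : Submodule (Module.End A M) M) (hZ : Z ≠ ⊤) :
    ∃ Z' : Submodule (Module.End A M) M, Z ≤ Z' ∧ Z' ≠ ⊤ ∧
      ∀ r : Module.End A M, ¬ IsUnit r → ∀ x, r x ∈ Z' := by
  have : IsNoetherian A M := isNoetherian_of_tower K inferInstance
  have : IsArtinian A M := isArtinian_of_tower K inferInstance
  have : IsNoetherian (Module.End A M) M := isNoetherian_of_tower K inferInstance
  obtain ⟨Z', hZ', hle⟩ := (eq_top_or_exists_le_coatom Z).resolve_left hZ
  refine ⟨Z', hle, hZ'.1, fun r hr x => ?_⟩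
  by_contra hx
  have htop : Z' ⊔ Submodule.span (Module.End A M) {r x} = ⊤ :=
    hZ'.2 _ (lt_of_le_of_ne le_sup_left fun h => hx
      (h ▸ Submodule.mem_sup_right (Submodule.mem_span_singleton_self _)))
  obtain ⟨z, hz, y, hy, hzy⟩ := Submodule.mem_sup.1 (htop ▸ Submodule.mem_top : x ∈ _)
  obtain ⟨e, rfl⟩ := Submodule.mem_span_singleton.1 hy
  -- `x = z + e (r x)` where `e * r` is nilpotent, so that `1 - e * r` is invertible.
  have her : ¬ IsUnit (e * r) := by
    intro h
    apply hr
    have hinj : Function.Injective r :=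
      Function.Injective.of_comp (f := e) ((Module.End.isUnit_iff _).1 h).1
    exact (Module.End.isUnit_iff _).2 (IsArtinian.bijective_of_injective_endomorphism r hinj)
  obtain ⟨w, hw⟩ := ((hM.isUnit_or_isNilpotent (e * r)).resolve_left her).isUnit_one_sub
  have h1 : (w : Module.End A M) x = z := by
    rw [hw, ← sub_eq_iff_eq_add.2 hzy.symm]
    simp
  have h2 : x ∈ Z' := by
    have : x = (↑w⁻¹ : Module.End A M) • z := by
      rw [← h1, ← Module.End.smul_def, smul_smul, Units.inv_mul, one_smul]
    rw [this]
    exact Z'.smul_mem _ hz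
  exact hx (Z'.smul_mem r h2)

/-- A weak form of the Krull–Schmidt theorem: an indecomposable direct summand of a finite direct
sum of indecomposable modules is isomorphic to one of them. -/
theorem IsIndecomposableModule.exists_nonempty_linearEquiv_of_retract {K : Type*} [Field K]
    [Algebra K A] [Module K M] [IsScalarTower K A M] [FiniteDimensional K M]
    (hM : IsIndecomposableModule A M) {ι : Type*} [Fintype ι] (X : ι → Type u)
    [∀ i, AddCommGroup (X i)] [∀ i, Module A (X i)] (hX : ∀ i, IsIndecomposableModule A (X i))
    (f : M →ₗ[A] ∀ i, X i) (g : (∀ i, X i) →ₗ[A] M) (hgf : g ∘ₗ f = LinearMap.id) :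
    ∃ i, Nonempty (M ≃ₗ[A] X i) := by
  classical
  have := hM.1
  by_contra! hne
  obtain ⟨Z, -, hZ, hr⟩ := hM.exists_ne_top_forall_not_isUnit (K := K) ⊥ bot_ne_top
  apply hZ
  rw [eq_top_iff]
  rintro x -
  have hx : x = ∑ i, ((g ∘ₗ LinearMap.single A X i) ∘ₗ (LinearMap.proj i ∘ₗ f)) x := by
    conv_lhs => rw [← LinearMap.id_apply (R := A) x, ← hgf]
    simp only [LinearMap.comp_apply, LinearMap.proj_apply, LinearMap.coe_single]
    rw [← map_sum, Finset.univ_sum_single]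
  rw [hx]
  refine Submodule.sum_mem _ fun i _ => hr _ (fun hu => ?_) x
  exact (hne i).elim ((hX i).nonempty_linearEquiv_of_isUnit_comp _ _ hu).some

end Indecomposable

/-! ### Traces of families of modules -/

section Trace

variable {A : Type u} [Ring A] {ι : Type*} (M : ι → Type u) [∀ i, AddCommGroup (M i)]
  [∀ i, Module A (M i)]

/-- The trace in `X` of the modules `M j` with `j ∈ F`: the largest submodule of `X` generated by
these modules. -/
def familyTrace (F : Set ι) (X : Type u) [AddCommGroup X] [Module A X] : Submodule A X :=
  ⨆ q : Σ j : F, (M j →ₗ[A] X), LinearMap.range q.2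

variable {M} {X Y : Type u} [AddCommGroup X] [Module A X] [AddCommGroup Y] [Module A Y]

theorem apply_mem_familyTrace {F : Set ι} {j : ι} (hj : j ∈ F) (φ : M j →ₗ[A] X) (y : M j) :
    φ y ∈ familyTrace (A := A) M F X :=
  le_iSup (fun q : Σ j : F, (M j →ₗ[A] X) => LinearMap.range q.2) ⟨⟨j, hj⟩, φ⟩ ⟨y, rfl⟩

theorem familyTrace_induction {F : Set ι} {C : X → Prop} {x : X}
    (hx : x ∈ familyTrace (A := A) M F X)
    (h : ∀ j ∈ F, ∀ (φ : M j →ₗ[A] X) (y : M j), C (φ y)) (h0 : C 0)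
    (hadd : ∀ x y, C x → C y → C (x + y)) : C x := by
  refine Submodule.iSup_induction (fun q : Σ j : F, (M j →ₗ[A] X) => LinearMap.range q.2)
    (motive := C) hx ?_ h0 hadd
  rintro ⟨⟨j, hj⟩, φ⟩ _ ⟨y, rfl⟩
  exact h j hj φ y

theorem map_mem_familyTrace {F : Set ι} (ψ : X →ₗ[A] Y) {x : X}
    (hx : x ∈ familyTrace (A := A) M F X) : ψ x ∈ familyTrace (A := A) M F Y := by
  refine familyTrace_induction (C := fun x => ψ x ∈ familyTrace (A := A) M F Y) hx
    (fun j hj φ y => apply_mem_familyTrace hj (ψ ∘ₗ φ) y) (by simp) (fun x y hx hy => ?_)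
  simpa using add_mem hx hy

theorem familyTrace_le_of_forall_eq_top {F G : Set ι}
    (h : ∀ j ∈ G, familyTrace (A := A) M F (M j) = ⊤) :
    familyTrace (A := A) M G X ≤ familyTrace (A := A) M F X := by
  intro x hx
  refine familyTrace_induction (C := fun x => x ∈ familyTrace (A := A) M F X) hx
    (fun j hj φ y => map_mem_familyTrace φ (by rw [h j hj]; trivial)) (zero_mem _)
    (fun x y hx hy => add_mem hx hy)

/-- Among pairwise non-isomorphic indecomposable modules, it is impossible that each one is
generated by the others: an element of a minimal generating subfamily would be generated by the rest
of that subfamily and by the images of its own non-invertible endomorphisms, and the latter are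
superfluous by the Nakayama lemma. -/
theorem eq_empty_of_forall_familyTrace_diff_eq_top {K : Type*} [Field K] [Algebra K A] [Finite ι]
    [∀ i, Module K (M i)] [∀ i, IsScalarTower K A (M i)] [∀ i, FiniteDimensional K (M i)]
    (hM : ∀ i, IsIndecomposableModule A (M i)) (hne : ∀ i j, i ≠ j → IsEmpty (M i ≃ₗ[A] M j))
    (S : Set ι) (hS : ∀ i ∈ S, familyTrace (A := A) M (S \ {i}) (M i) = ⊤) : S = ∅ := by
  classical
  -- `gen F`: the modules indexed by `F ⊆ S` generate all those indexed by `S`.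
  let gen : Set ι → Prop := fun F => F ⊆ S ∧ ∀ i ∈ S, familyTrace (A := A) M F (M i) = ⊤
  have hgen : gen S := by
    refine ⟨subset_rfl, fun i hi => ?_⟩
    rw [eq_top_iff]
    rintro x -
    exact apply_mem_familyTrace hi LinearMap.id x
  obtain ⟨F, -, hF⟩ := (Set.toFinite {F | gen F}).exists_le_minimal hgen
  rcases F.eq_empty_or_nonempty with rfl | ⟨j, hj⟩
  · by_contra hSne
    obtain ⟨i, hi⟩ := Set.nonempty_iff_ne_empty.2 hSne
    have := (hM i).1
    have h0 := hF.1.2 i hi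
    obtain ⟨x, hx⟩ := exists_ne (0 : M i)
    have hxm : x ∈ familyTrace (A := A) M ∅ (M i) := by rw [h0]; trivial
    exact hx (familyTrace_induction (C := fun x => x = 0) hxm (fun j hj => hj.elim) rfl
      fun x y hx hy => by rw [hx, hy, add_zero])
  exfalso
  have hjS := hF.1.1 hj
  have := (hM j).1
  -- Maps `M f → M i → M j` with `f ≠ j` land in the trace of `F \ {j}`, and those with `f = j` are
  -- not invertible because `M i` is not isomorphic to `M j`.
  have key : familyTrace (A := A) M (F \ {j}) (M j) = ⊤ := by
    by_contra hZ
    let Z : Submodule (Module.End A (M j)) (M j) :=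
      { (familyTrace (A := A) M (F \ {j}) (M j)).toAddSubmonoid with
        smul_mem' := fun e x hx => map_mem_familyTrace e hx }
    have hZtop : Z ≠ ⊤ := fun h => hZ (by
      rw [eq_top_iff]
      rintro x -
      exact (h ▸ Submodule.mem_top : x ∈ Z))
    obtain ⟨Z', hle, hZ', hr⟩ := (hM j).exists_ne_top_forall_not_isUnit (K := K) Z hZtop
    apply hZ'
    rw [eq_top_iff]
    rintro x -
    have hx : x ∈ familyTrace (A := A) M (S \ {j}) (M j) := by rw [hS j hjS]; trivial
    refine familyTrace_induction (C := fun x => x ∈ Z') hx ?_ (zero_mem _)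
      fun x y hx hy => add_mem hx hy
    rintro i ⟨hi, hij⟩ φ y
    have hy : y ∈ familyTrace (A := A) M F (M i) := by rw [hF.1.2 i hi]; trivial
    refine familyTrace_induction (C := fun y => φ y ∈ Z') hy ?_ (by simp)
      fun x y hx hy => by simpa using add_mem hx hy
    intro f hf ψ w
    by_cases hfj : f = j
    · subst hfj
      refine hr (φ ∘ₗ ψ) (fun hu => ?_) w
      exact (hne f i (Ne.symm hij)).elim
        ((hM i).nonempty_linearEquiv_of_isUnit_comp ψ φ hu).some
    · exact hle (apply_mem_familyTrace (F := F \ {j}) ⟨hf, hfj⟩ (φ ∘ₗ ψ) w)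
  have hgen' : gen (F \ {j}) := by
    refine ⟨Set.sdiff_subset.trans hF.1.1, fun i hi => ?_⟩
    rw [eq_top_iff, ← hF.1.2 i hi]
    refine familyTrace_le_of_forall_eq_top fun f hf => ?_
    by_cases hfj : f = j
    · subst hfj; exact key
    · rw [eq_top_iff]
      rintro x -
      exact apply_mem_familyTrace (F := F \ {j}) ⟨hf, hfj⟩ LinearMap.id x
  exact (hF.2 hgen' Set.sdiff_subset hj).2 rfl

end Trace

/-! ### Extension of maps from the kernel of a presentation -/

section ExtendsFromKer

variable {A : Type u} [Ring A] {P M : Type u} [AddCommGroup P] [Module A P]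
  [AddCommGroup M] [Module A M]

/-- Every map from the kernel of `p : P → M` to `X` extends to `P`. If `p` is surjective and `P` is
projective, this says that `Ext¹(M, X) = 0`. -/
def ExtendsFromKer (p : P →ₗ[A] M) (X : Type u) [AddCommGroup X] [Module A X] : Prop :=
  ∀ h : LinearMap.ker p →ₗ[A] X, ∃ h' : P →ₗ[A] X, h' ∘ₗ (LinearMap.ker p).subtype = h

variable {p : P →ₗ[A] M} {X Y : Type u} [AddCommGroup X] [Module A X] [AddCommGroup Y] [Module A Y]

/-- If `ker p` is projective, `Ext¹(M, -)` is right exact, so its vanishing passes to quotients. -/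
theorem ExtendsFromKer.of_surjective [Module.Projective A (LinearMap.ker p)]
    (hX : ExtendsFromKer p X) (g : X →ₗ[A] Y) (hg : Function.Surjective g) :
    ExtendsFromKer p Y := by
  intro h
  obtain ⟨k, hk⟩ := Module.projective_lifting_property g h hg
  obtain ⟨h', hh'⟩ := hX k
  exact ⟨g ∘ₗ h', by rw [LinearMap.comp_assoc, hh', hk]⟩

theorem ExtendsFromKer.sup [Module.Projective A (LinearMap.ker p)] {S T : Submodule A X}
    (hS : ExtendsFromKer p S) (hT : ExtendsFromKer p T) :
    ExtendsFromKer p (S ⊔ T : Submodule A X) := by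
  have hprod : ExtendsFromKer p (S × T) := by
    intro h
    obtain ⟨a, ha⟩ := hS (LinearMap.fst A S T ∘ₗ h)
    obtain ⟨b, hb⟩ := hT (LinearMap.snd A S T ∘ₗ h)
    refine ⟨a.prod b, LinearMap.ext fun x => Prod.ext ?_ ?_⟩
    · exact LinearMap.congr_fun ha x
    · exact LinearMap.congr_fun hb x
  refine hprod.of_surjective
    (LinearMap.coprod (Submodule.inclusion le_sup_left) (Submodule.inclusion le_sup_right)) ?_
  rintro ⟨x, hx⟩
  obtain ⟨s, hs, t, ht, rfl⟩ := Submodule.mem_sup.1 hx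
  exact ⟨(⟨s, hs⟩, ⟨t, ht⟩), rfl⟩

theorem ExtendsFromKer.iSup [Module.Projective A (LinearMap.ker p)] [IsNoetherian A X]
    {κ : Type*} (S : κ → Submodule A X) (hS : ∀ k, ExtendsFromKer p (S k)) :
    ExtendsFromKer p (⨆ k, S k : Submodule A X) := by
  -- By the ascending chain condition there is a largest submodule with this property among those
  -- below the supremum.
  obtain ⟨T, ⟨hT, hTle⟩, hmax⟩ := set_has_maximal_iff_noetherian.2
    (inferInstance : IsNoetherian A X)
    {T : Submodule A X | ExtendsFromKer p T ∧ T ≤ ⨆ k, S k} ⟨⊥, fun h => ⟨0, by ext x⟩, bot_le⟩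
  have : ⨆ k, S k = T := by
    refine le_antisymm (iSup_le fun k => ?_) hTle
    by_contra hk
    exact hmax (T ⊔ S k) ⟨hT.sup (hS k), sup_le hTle (le_iSup S k)⟩
      (lt_of_le_of_ne le_sup_left fun h => hk (h ▸ le_sup_right))
  rwa [this]

theorem ExtendsFromKer.familyTrace [Module.Projective A (LinearMap.ker p)] [IsNoetherian A X]
    {ι : Type*} {M' : ι → Type u} [∀ i, AddCommGroup (M' i)] [∀ i, Module A (M' i)]
    (h : ∀ i, ExtendsFromKer p (M' i)) (F : Set ι) :
    ExtendsFromKer p (_root_.familyTrace (A := A) M' F X) :=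
  ExtendsFromKer.iSup _ fun q =>
    (h q.1).of_surjective (LinearMap.rangeRestrict q.2) (LinearMap.surjective_rangeRestrict _)

/-- Maps out of `M` lift along quotients by submodules `Z` with `Ext¹(M, Z) = 0`. -/
theorem ExtendsFromKer.exists_lift [Module.Projective A P] (hp : Function.Surjective p)
    {Z : Submodule A X} (hZ : ExtendsFromKer p Z) (f : M →ₗ[A] X ⧸ Z) :
    ∃ f' : M →ₗ[A] X, Z.mkQ ∘ₗ f' = f := by
  obtain ⟨g, hg⟩ := Module.projective_lifting_property Z.mkQ (f ∘ₗ p) Z.mkQ_surjective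
  have hgZ : ∀ x : LinearMap.ker p, (g ∘ₗ (LinearMap.ker p).subtype) x ∈ Z := by
    intro x
    have := LinearMap.congr_fun hg x
    simpa using this
  obtain ⟨k, hk⟩ := hZ ((g ∘ₗ (LinearMap.ker p).subtype).codRestrict Z hgZ)
  have hle : LinearMap.ker p ≤ LinearMap.ker (g - Z.subtype ∘ₗ k) := by
    intro x hx
    have := congrArg Subtype.val (LinearMap.congr_fun hk ⟨x, hx⟩)
    simpa [sub_eq_zero] using this.symm
  let e := p.quotKerEquivOfSurjective hp
  refine ⟨(LinearMap.ker p).liftQ _ hle ∘ₗ e.symm.toLinearMap, LinearMap.ext fun m => ?_⟩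
  obtain ⟨x, rfl⟩ := hp m
  have hx : e.symm (p x) = (LinearMap.ker p).mkQ x := by
    rw [LinearEquiv.symm_apply_eq]; rfl
  have := LinearMap.congr_fun hg x
  simp only [LinearMap.comp_apply, LinearEquiv.coe_coe, hx, Submodule.mkQ_apply,
    Submodule.liftQ_apply, LinearMap.sub_apply, Submodule.subtype_apply,
    Submodule.Quotient.mk_sub] at this ⊢
  rw [this, (Submodule.Quotient.mk_eq_zero Z).2 (k x).2, sub_zero]

end ExtendsFromKer

/-! ### Dimensions of spaces of homomorphisms -/

section HomDimension

variable {K : Type*} {A : Type u} [Field K] [Ring A] [Algebra K A]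
  {P Q R : Type u} [AddCommGroup P] [Module A P] [AddCommGroup Q] [Module A Q]
  [AddCommGroup R] [Module A R] [Module K R] [IsScalarTower K A R]

variable (K A P Q) in
theorem finiteDimensional_linearMap [Module K P] [IsScalarTower K A P] [Module K Q]
    [IsScalarTower K A Q] [FiniteDimensional K P] [FiniteDimensional K Q] :
    FiniteDimensional K (P →ₗ[A] Q) :=
  Module.Finite.of_injective (LinearMap.restrictScalarsₗ K A P Q K)
    (LinearMap.restrictScalars_injective K)

theorem finrank_eq_add_of_exact {U V W : Type*} [AddCommGroup U] [Module K U]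
    [AddCommGroup V] [Module K V] [AddCommGroup W] [Module K W] [FiniteDimensional K V]
    (f : U →ₗ[K] V) (g : V →ₗ[K] W) (hf : Function.Injective f) (hfg : Function.Exact f g)
    (hg : Function.Surjective g) :
    Module.finrank K V = Module.finrank K U + Module.finrank K W := by
  rw [← LinearMap.finrank_range_add_finrank_ker g, LinearMap.range_eq_top.2 hg, finrank_top,
    LinearMap.exact_iff.1 hfg, LinearMap.finrank_range_of_inj hf, add_comm]

variable (K) in
/-- Composition with a fixed `A`-linear map on the left, as a `K`-linear map. -/
def homCompLeft [Module K Q] [IsScalarTower K A Q] (g : Q →ₗ[A] R) :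
    (P →ₗ[A] Q) →ₗ[K] (P →ₗ[A] R) where
  toFun f := g ∘ₗ f
  map_add' _ _ := LinearMap.comp_add _ _ _
  map_smul' c f := by ext x; simp [LinearMap.map_smul_of_tower]

variable (K) in
/-- Composition with a fixed `A`-linear map on the right, as a `K`-linear map. -/
def homCompRight (g : P →ₗ[A] Q) : (Q →ₗ[A] R) →ₗ[K] (P →ₗ[A] R) where
  toFun f := f ∘ₗ g
  map_add' _ _ := LinearMap.add_comp _ _ _
  map_smul' _ _ := rfl

theorem finrank_linearMap_eq_add_quotient [Module K P] [IsScalarTower K A P] [Module K Q]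
    [IsScalarTower K A Q] [Module.Projective A P] [FiniteDimensional K P] [FiniteDimensional K Q]
    (S : Submodule A Q) :
    Module.finrank K (P →ₗ[A] Q) =
      Module.finrank K (P →ₗ[A] S) + Module.finrank K (P →ₗ[A] Q ⧸ S) := by
  have := finiteDimensional_linearMap K A P Q
  refine finrank_eq_add_of_exact (homCompLeft K S.subtype) (homCompLeft K S.mkQ) ?_ ?_ ?_
  · intro f g h
    ext x
    exact LinearMap.congr_fun h x
  · intro f
    constructor
    · intro h
      refine ⟨f.codRestrict S fun x => ?_, LinearMap.ext fun x => rfl⟩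
      exact (Submodule.Quotient.mk_eq_zero S).1 (LinearMap.congr_fun h x)
    · rintro ⟨g, rfl⟩
      ext x
      exact (Submodule.Quotient.mk_eq_zero S).2 (g x).2
  · intro f
    exact Module.projective_lifting_property S.mkQ f S.mkQ_surjective

theorem finrank_linearMap_congr [Module K Q] [IsScalarTower K A Q] (e : Q ≃ₗ[A] R) :
    Module.finrank K (P →ₗ[A] Q) = Module.finrank K (P →ₗ[A] R) :=
  LinearEquiv.finrank_eq (LinearEquiv.ofBijective (homCompLeft K e.toLinearMap)
    ⟨fun _ _ h => LinearMap.ext fun x => e.injective (LinearMap.congr_fun h x),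
      fun f => ⟨e.symm.toLinearMap ∘ₗ f, LinearMap.ext fun x => e.apply_symm_apply (f x)⟩⟩)

variable (K) in
/-- The difference `dim Hom(P, X) - dim Hom(ker p, X)` for `p : P → M`. If `p` is surjective and
both `P` and `ker p` are projective, this is the Euler form `dim Hom(M, X) - dim Ext¹(M, X)`. -/
noncomputable def eulerForm (p : P →ₗ[A] Q) (X : Type u) [AddCommGroup X] [Module A X] [Module K X]
    [IsScalarTower K A X] : ℤ :=
  (Module.finrank K (P →ₗ[A] X) : ℤ) - Module.finrank K (LinearMap.ker p →ₗ[A] X)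

theorem eulerForm_eq_add_quotient [Module K P] [IsScalarTower K A P] (p : P →ₗ[A] Q)
    [Module.Projective A P] [Module.Projective A (LinearMap.ker p)] [FiniteDimensional K P]
    [FiniteDimensional K R] (S : Submodule A R) :
    eulerForm K p R = eulerForm K p S + eulerForm K p (R ⧸ S) := by
  have : FiniteDimensional K (LinearMap.ker p) :=
    inferInstanceAs (FiniteDimensional K ((LinearMap.ker p).restrictScalars K))
  simp only [eulerForm, finrank_linearMap_eq_add_quotient (K := K) S, Nat.cast_add]
  ring

theorem eulerForm_congr (p : P →ₗ[A] Q) {X Y : Type u} [AddCommGroup X] [Module A X] [Module K X]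
    [IsScalarTower K A X] [AddCommGroup Y] [Module A Y] [Module K Y] [IsScalarTower K A Y]
    (e : X ≃ₗ[A] Y) : eulerForm K p X = eulerForm K p Y := by
  simp only [eulerForm, finrank_linearMap_congr (K := K) e]

/-- The Euler form `⟨M, X⟩` is `dim Hom(M, X)` when `Ext¹(M, X) = 0`. -/
theorem ExtendsFromKer.eulerForm_eq [Module K P] [IsScalarTower K A P] [FiniteDimensional K P]
    [FiniteDimensional K R] {p : P →ₗ[A] Q} (hp : Function.Surjective p) (h : ExtendsFromKer p R) :
    eulerForm K p R = Module.finrank K (Q →ₗ[A] R) := by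
  have := finiteDimensional_linearMap K A P R
  have := finrank_eq_add_of_exact (homCompRight K p)
    (homCompRight (R := R) K (LinearMap.ker p).subtype) ?_ ?_ h
  · rw [eulerForm, this]; simp
  · intro f g h
    ext x
    obtain ⟨y, rfl⟩ := hp x
    exact LinearMap.congr_fun h y
  · intro f
    constructor
    · intro hf
      have hle : LinearMap.ker p ≤ LinearMap.ker f := fun x hx => LinearMap.congr_fun hf ⟨x, hx⟩
      refine ⟨(LinearMap.ker p).liftQ f hle ∘ₗ (p.quotKerEquivOfSurjective hp).symm.toLinearMap,
        LinearMap.ext fun x => ?_⟩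
      have hx : (p.quotKerEquivOfSurjective hp).symm (p x) = (LinearMap.ker p).mkQ x := by
        rw [LinearEquiv.symm_apply_eq]; rfl
      change (LinearMap.ker p).liftQ f hle ((p.quotKerEquivOfSurjective hp).symm (p x)) = f x
      rw [hx, Submodule.mkQ_apply, Submodule.liftQ_apply]
    · rintro ⟨g, rfl⟩
      ext x
      change g (p x) = 0
      rw [x.2, map_zero]

end HomDimension

/-! ### Rigid families of projective dimension at most one -/

section Rank

variable {K : Type*} {A : Type u} [Field K] [Ring A] [Algebra K A] {ι : Type*} [Fintype ι]
  {M P : ι → Type u} [∀ i, AddCommGroup (M i)] [∀ i, Module A (M i)]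
  [∀ i, AddCommGroup (P i)] [∀ i, Module A (P i)] [∀ i, Module K (P i)]
  [∀ i, IsScalarTower K A (P i)] [∀ i, FiniteDimensional K (P i)]
  [∀ i, Module.Projective A (P i)] (p : ∀ i, P i →ₗ[A] M i)

/-- A linear combination of Euler forms that vanishes on the simple modules vanishes on all
finite-dimensional modules. -/
theorem sum_mul_eulerForm_eq_zero [∀ i, Module.Projective A (LinearMap.ker (p i))] (a : ι → ℤ)
    (h : ∀ (S : Type u) [AddCommGroup S] [Module A S] [Module K S] [IsScalarTower K A S],
      IsSimpleModule A S → ∑ i, a i * eulerForm K (p i) S = 0)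
    (X : Type u) [AddCommGroup X] [Module A X] [Module K X] [IsScalarTower K A X]
    [FiniteDimensional K X] : ∑ i, a i * eulerForm K (p i) X = 0 := by
  suffices H : ∀ (n : ℕ) (X : Type u) [AddCommGroup X] [Module A X] [Module K X]
      [IsScalarTower K A X] [FiniteDimensional K X], Module.finrank K X = n →
      ∑ i, a i * eulerForm K (p i) X = 0 from H _ X rfl
  intro n
  induction n using Nat.strong_induction_on with
  | _ n ih =>
    intro X _ _ _ _ _ hn
    rcases subsingleton_or_nontrivial X with hX | hX
    · have : ∀ Q : Type u, ∀ [AddCommGroup Q] [Module A Q], Subsingleton (Q →ₗ[A] X) :=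
        fun Q _ _ => ⟨fun f g => LinearMap.ext fun x => Subsingleton.elim _ _⟩
      simp [eulerForm, Module.finrank_zero_of_subsingleton]
    · have : IsArtinian A X := isArtinian_of_tower K inferInstance
      obtain ⟨S, hS, -⟩ := (eq_bot_or_exists_atom_le (⊤ : Submodule A X)).resolve_left top_ne_bot
      have hfin : FiniteDimensional K S :=
        inferInstanceAs (FiniteDimensional K (S.restrictScalars K))
      have hSs : IsSimpleModule A S := isSimpleModule_iff_isAtom.2 hS
      have hpos : 0 < Module.finrank K S := by
        have := hSs.nontrivial
        exact Module.finrank_pos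
      have hrank : Module.finrank K (X ⧸ S) + Module.finrank K S = Module.finrank K X :=
        Submodule.finrank_quotient_add_finrank (S.restrictScalars K)
      have hq : FiniteDimensional K (X ⧸ S) :=
        inferInstanceAs (FiniteDimensional K (X ⧸ S.restrictScalars K))
      have h1 := h S hSs
      have h2 := ih (Module.finrank K (X ⧸ S)) (by omega) (X ⧸ S) rfl
      simp only [eulerForm_eq_add_quotient (K := K) _ S, mul_add, Finset.sum_add_distrib, h1, h2,
        add_zero]

/-- If a linear combination of the Euler forms of a rigid family vanishes, then the members with
positive coefficient are generated by those with negative coefficient: on the quotient of such a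
member by the trace of the latter, the Euler forms are the dimensions of the spaces of
homomorphisms, and those coming from the latter modules are zero. -/
theorem familyTrace_eq_top_of_sum_mul_eulerForm_eq_zero [∀ i, Module K (M i)]
    [∀ i, IsScalarTower K A (M i)] [∀ i, FiniteDimensional K (M i)]
    [∀ i, Module.Projective A (LinearMap.ker (p i))] (hp : ∀ i, Function.Surjective (p i))
    (hext : ∀ i j, ExtendsFromKer (p i) (M j)) (a : ι → ℤ)
    (ha : ∀ (X : Type u) [AddCommGroup X] [Module A X] [Module K X] [IsScalarTower K A X]
      [FiniteDimensional K X], ∑ i, a i * eulerForm K (p i) X = 0)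
    (i : ι) (hi : 0 < a i) : familyTrace (A := A) M {j | a j < 0} (M i) = ⊤ := by
  set Z := familyTrace (A := A) M {j | a j < 0} (M i)
  have : IsNoetherian A (M i) := isNoetherian_of_tower K inferInstance
  have hfin : FiniteDimensional K (M i ⧸ Z) :=
    inferInstanceAs (FiniteDimensional K (M i ⧸ Z.restrictScalars K))
  have hsum := ha (M i ⧸ Z)
  have heq : ∀ k, eulerForm K (p k) (M i ⧸ Z) = Module.finrank K (M k →ₗ[A] M i ⧸ Z) := fun k =>
    ((hext k i).of_surjective Z.mkQ Z.mkQ_surjective).eulerForm_eq (hp k)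
  have hzero : ∀ j, a j < 0 → Module.finrank K (M j →ₗ[A] M i ⧸ Z) = 0 := by
    intro j hj
    have : Subsingleton (M j →ₗ[A] M i ⧸ Z) := by
      refine subsingleton_of_forall_eq 0 fun f => ?_
      have hZj : ExtendsFromKer (p j) Z := ExtendsFromKer.familyTrace (hext j) _
      obtain ⟨f', rfl⟩ := hZj.exists_lift (hp j) f
      ext x
      exact (Submodule.Quotient.mk_eq_zero Z).2 (apply_mem_familyTrace (F := {j | a j < 0}) hj f' x)
    exact Module.finrank_zero_of_subsingleton
  have hnonneg : ∀ k ∈ Finset.univ, 0 ≤ a k * eulerForm K (p k) (M i ⧸ Z) := by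
    intro k _
    rw [heq]
    rcases lt_or_ge (a k) 0 with hk | hk
    · simp [hzero k hk]
    · exact mul_nonneg hk (Nat.cast_nonneg _)
  have h0 := (Finset.sum_eq_zero_iff_of_nonneg hnonneg).1 hsum i (Finset.mem_univ i)
  rw [heq, mul_eq_zero, or_iff_right hi.ne', Nat.cast_eq_zero] at h0
  have := finiteDimensional_linearMap K A (M i) (M i ⧸ Z)
  have hsub : Subsingleton (M i →ₗ[A] M i ⧸ Z) := Module.finrank_zero_iff.1 h0
  rw [← Z.ker_mkQ, Subsingleton.elim Z.mkQ 0, LinearMap.ker_zero]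

/-- A rigid family of pairwise non-isomorphic indecomposable modules of projective dimension at most
one has at most as many members as there are simple modules: its Euler forms are linearly
independent in the dual of the Grothendieck group. -/
theorem card_le_numSimpleModules {K : Type*} {A : Type u} [Field K] [Ring A] [Algebra K A]
    {ι : Type*} [Fintype ι] {M P : ι → Type u} [∀ i, AddCommGroup (M i)] [∀ i, Module A (M i)]
    [∀ i, Module K (M i)] [∀ i, IsScalarTower K A (M i)] [∀ i, FiniteDimensional K (M i)]
    [∀ i, AddCommGroup (P i)] [∀ i, Module A (P i)] [∀ i, Module K (P i)]
    [∀ i, IsScalarTower K A (P i)] [∀ i, FiniteDimensional K (P i)]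
    [∀ i, Module.Projective A (P i)] (p : ∀ i, P i →ₗ[A] M i)
    [∀ i, Module.Projective A (LinearMap.ker (p i))]
    (hp : ∀ i, Function.Surjective (p i)) (hext : ∀ i j, ExtendsFromKer (p i) (M j))
    (hM : ∀ i, IsIndecomposableModule A (M i)) (hne : ∀ i j, i ≠ j → IsEmpty (M i ≃ₗ[A] M j)) :
    (Fintype.card ι : ℕ∞) ≤ numSimpleModules A := by
  by_contra hlt
  rw [not_le, numSimpleModules] at hlt
  have hfin : Finite (Quotient (simpleModuleSetoid A)) :=
    ENat.card_lt_top.1 (hlt.trans (ENat.natCast_lt_top _))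
  have := Fintype.ofFinite (Quotient (simpleModuleSetoid A))
  rw [ENat.card_eq_coe_fintype_card, Nat.cast_lt] at hlt
  let inst (S : SimpleModuleOver A) : Module K S.1 := Module.compHom _ (algebraMap K A)
  have inst' (S : SimpleModuleOver A) : IsScalarTower K A S.1 := IsScalarTower.of_algebraMap_smul
    fun _ _ => rfl
  -- By additivity, Euler forms are determined by their values on representatives of the simples.
  let v : ι → Quotient (simpleModuleSetoid A) → ℤ := fun i c => eulerForm K (p i) c.out.1
  have hdep : ¬ LinearIndependent ℤ v := fun h => by
    have := h.fintype_card_le_finrank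
    rw [Module.finrank_fintype_fun_eq_card] at this
    omega
  obtain ⟨a, ha, i₀, hi₀⟩ := Fintype.not_linearIndependent_iff.1 hdep
  have hall : ∀ (X : Type u) [AddCommGroup X] [Module A X] [Module K X] [IsScalarTower K A X]
      [FiniteDimensional K X], ∑ i, a i * eulerForm K (p i) X = 0 := by
    refine fun X => sum_mul_eulerForm_eq_zero p a (fun S => ?_) X
    intro _ _ _ _ hS
    let S' : SimpleModuleOver A := ⟨ModuleCat.of A S, hS⟩
    obtain ⟨e⟩ : Nonempty ((⟦S'⟧ : Quotient (simpleModuleSetoid A)).out.1 ≃ₗ[A] S'.1) :=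
      Quotient.mk_out (s := simpleModuleSetoid A) S'
    have e' : (⟦S'⟧ : Quotient (simpleModuleSetoid A)).out.1 ≃ₗ[A] S := e
    have := congrFun ha ⟦S'⟧
    simpa [v, Finset.sum_apply, eulerForm_congr (K := K) _ e'] using this
  -- The members with positive coefficient and those with negative coefficient generate each other.
  have hpos := familyTrace_eq_top_of_sum_mul_eulerForm_eq_zero p hp hext a hall
  have hneg := familyTrace_eq_top_of_sum_mul_eulerForm_eq_zero p hp hext (fun i => -a i)
    (fun X _ _ _ _ _ => by simpa using hall X)
  have hempty : {i | a i ≠ 0} = ∅ := by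
    refine eq_empty_of_forall_familyTrace_diff_eq_top (K := K) hM hne _ fun i hi => ?_
    have hmono : ∀ {F G : Set ι}, F ⊆ G → familyTrace (A := A) M F (M i) = ⊤ →
        familyTrace (A := A) M G (M i) = ⊤ := by
      intro F G hFG hF
      rw [eq_top_iff, ← hF]
      exact iSup_le fun q => le_iSup (fun q : Σ j : G, (M j →ₗ[A] M i) => LinearMap.range q.2)
        ⟨⟨q.1, hFG q.1.2⟩, q.2⟩
    rcases lt_or_gt_of_ne (hi : a i ≠ 0) with h | h
    · refine hmono ?_ (hneg i (by simpa using h))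
      rintro j hj
      have hj : 0 < a j := by simpa using hj
      exact ⟨hj.ne', fun hji => by rw [Set.mem_singleton_iff.1 hji] at hj; omega⟩
    · refine hmono ?_ (hpos i h)
      rintro j (hj : a j < 0)
      exact ⟨hj.ne, fun hji => by rw [Set.mem_singleton_iff.1 hji] at hj; omega⟩
  exact (hempty ▸ (show i₀ ∈ {i | a i ≠ 0} from hi₀) : i₀ ∈ (∅ : Set ι))

end Rank

/-! ### Extensions and projective dimension in terms of presentations -/

section Ext

open CategoryTheory

variable {A : Type u} [Ring A] {P M X : Type u} [AddCommGroup P] [Module A P]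
  [AddCommGroup M] [Module A M] [AddCommGroup X] [Module A X]

/-- If no extension of `M` by `X` is non-split, maps from `ker p` to `X` extend to `P`: split the
pushout of `0 → ker p → P → M → 0` along the given map. -/
theorem extendsFromKer_of_not_existsNonsplitExtension {p : P →ₗ[A] M}
    (hp : Function.Surjective p) (h : ¬ ExistsNonsplitExtension A X M) : ExtendsFromKer p X := by
  intro k
  let R : Submodule A (X × P) := LinearMap.range (k.prod (-(LinearMap.ker p).subtype))
  have hR : R ≤ LinearMap.ker (p ∘ₗ LinearMap.snd A X P) := by
    rintro _ ⟨l, rfl⟩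
    simp
  let f : X →ₗ[A] (X × P) ⧸ R := R.mkQ ∘ₗ LinearMap.inl A X P
  let g : (X × P) ⧸ R →ₗ[A] M := R.liftQ (p ∘ₗ LinearMap.snd A X P) hR
  have hf : Function.Injective f := by
    rw [injective_iff_map_eq_zero]
    intro x hx
    obtain ⟨l, hl⟩ := (Submodule.Quotient.mk_eq_zero R).1 hx
    have h2 : l = 0 := by
      have := congrArg Prod.snd hl
      simpa using this
    have h1 := congrArg Prod.fst hl
    simpa [h2] using h1.symm
  have hfg : Function.Exact f g := by
    intro v
    obtain ⟨⟨x, y⟩, rfl⟩ := R.mkQ_surjective v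
    constructor
    · intro hv
      have hy : y ∈ LinearMap.ker p := hv
      refine ⟨x + k ⟨y, hy⟩, (Submodule.Quotient.eq R).2 ⟨⟨y, hy⟩, ?_⟩⟩
      ext <;> simp
    · rintro ⟨x', hx'⟩
      rw [← hx']
      change p 0 = 0
      exact map_zero p
  have hg : Function.Surjective g := fun m => by
    obtain ⟨y, rfl⟩ := hp m
    exact ⟨R.mkQ (0, y), rfl⟩
  obtain ⟨r, hr⟩ : ∃ r : (X × P) ⧸ R →ₗ[A] X, r ∘ₗ f = LinearMap.id := by
    by_contra hne
    exact h ⟨_, _, _, f, g, hf, hfg, hg, hne⟩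
  refine ⟨r ∘ₗ R.mkQ ∘ₗ LinearMap.inr A X P, LinearMap.ext fun l => ?_⟩
  have h1 : R.mkQ (0, (l : P)) = f (k l) :=
    ((Submodule.Quotient.eq R).2 ⟨l, by ext <;> simp⟩ : R.mkQ (k l, 0) = R.mkQ (0, (l : P))).symm
  change r (R.mkQ (0, (l : P))) = k l
  rw [h1]
  exact LinearMap.congr_fun hr (k l)

/-- The short exact sequence `0 → ker p → P → M → 0` in the category of modules. -/
theorem shortExact_ker {p : P →ₗ[A] M} (hp : Function.Surjective p) :
    (ShortComplex.mk (ModuleCat.ofHom (LinearMap.ker p).subtype) (ModuleCat.ofHom p)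
      (by ext x; exact x.2)).ShortExact where
  exact := by
    rw [ShortComplex.ShortExact.moduleCat_exact_iff_function_exact]
    exact LinearMap.exact_subtype_ker_map p
  mono_f := (ModuleCat.mono_iff_injective _).2 (LinearMap.ker p).injective_subtype
  epi_g := (ModuleCat.epi_iff_surjective _).2 hp

theorem extendsFromKer_of_subsingleton_ext {p : P →ₗ[A] M} (hp : Function.Surjective p)
    (h : Subsingleton (Abelian.Ext.{u} (ModuleCat.of A M) (ModuleCat.of A X) 1)) :
    ExtendsFromKer p X := by
  intro k
  obtain ⟨x, hx⟩ := Abelian.Ext.contravariant_sequence_exact₁ (shortExact_ker hp)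
    (ModuleCat.of A X) (Abelian.Ext.mk₀ (ModuleCat.ofHom k)) (add_zero 1) (h.elim _ _)
  obtain ⟨f, rfl⟩ := Abelian.Ext.addEquiv₀.symm.surjective x
  refine ⟨f.hom, ?_⟩
  have h2 : ModuleCat.ofHom (LinearMap.ker p).subtype ≫ f = ModuleCat.ofHom k := by
    apply Abelian.Ext.addEquiv₀.symm.injective
    simpa using hx
  exact congrArg ModuleCat.Hom.hom h2

theorem subsingleton_ext_of_retract {C : Type*} [Category C] [Abelian C] [HasExt.{u} C]
    {M M' X X' : C} (rM : Retract M' M) (rX : Retract X' X) (n : ℕ)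
    (h : Subsingleton (Abelian.Ext.{u} M X n)) : Subsingleton (Abelian.Ext.{u} M' X' n) := by
  refine subsingleton_of_forall_eq 0 fun x => ?_
  have hx : (Abelian.Ext.mk₀ rM.i).comp (((Abelian.Ext.mk₀ rM.r).comp
      (x.comp (Abelian.Ext.mk₀ rX.i) (add_zero n)) (zero_add n)).comp
        (Abelian.Ext.mk₀ rX.r) (add_zero n)) (zero_add n) = x := by
    simp
  rw [← hx, Subsingleton.elim ((Abelian.Ext.mk₀ rM.r).comp
      (x.comp (Abelian.Ext.mk₀ rX.i) (add_zero n)) (zero_add n)) 0]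
  simp

theorem projective_ker_of_hasProjectiveDimensionLE_one [Module.Projective A P] {p : P →ₗ[A] M}
    (hp : Function.Surjective p) (h : HasProjectiveDimensionLE (ModuleCat.of A M) 1) :
    Module.Projective A (LinearMap.ker p) := by
  have hP : Projective (ModuleCat.of A P) := inferInstance
  have := ((shortExact_ker hp).hasProjectiveDimensionLT_X₃_iff 0 hP).1 h
  rw [IsProjective.iff_projective]
  exact projective_iff_hasProjectiveDimensionLT_one.2 this

/-- A factor of a finite product of modules is a retract of the product. -/
def retractPi {n : ℕ} (X : Fin n → Type u) [∀ i, AddCommGroup (X i)] [∀ i, Module A (X i)]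
    (i : Fin n) : Retract (ModuleCat.of A (X i)) (ModuleCat.of A ((i : Fin n) → X i)) where
  i := ModuleCat.ofHom (LinearMap.single A X i)
  r := ModuleCat.ofHom (LinearMap.proj i)
  retract := by ext x; simp

end Ext

/-! ### Tilting modules -/

section Tilting

variable {A : Type u} [Ring A] {n : ℕ} {X : Fin n → Type u}
  [∀ i, AddCommGroup (X i)] [∀ i, Module A (X i)]

/-- By the weak Krull–Schmidt theorem, every indecomposable summand of `⨁ X i` is isomorphic
to one of the `X i`. -/
theorem numIndecomposableSummands_pi_le {K : Type*} [Field K] [Algebra K A] [∀ i, Module K (X i)]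
    [∀ i, IsScalarTower K A (X i)] [∀ i, FiniteDimensional K (X i)]
    (hX : ∀ i, IsIndecomposableModule A (X i)) :
    numIndecomposableSummands A ((i : Fin n) → X i) ≤ n := by
  have key : ∀ N : IndecomposableSummand A ((i : Fin n) → X i), ∃ i, Nonempty (N.1 ≃ₗ[A] X i) := by
    rintro ⟨N, ⟨N', hN'⟩, hN⟩
    have : FiniteDimensional K N := inferInstanceAs (FiniteDimensional K (N.restrictScalars K))
    exact hN.exists_nonempty_linearEquiv_of_retract (K := K) X hX N.subtype
      (N.projectionOnto N' hN') (by ext x; simp)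
  choose c hc using key
  have hinj : Function.Injective fun q : Quotient (indecomposableSummandSetoid A
      ((i : Fin n) → X i)) => c q.out := by
    intro q q' h
    obtain ⟨e⟩ := hc q.out
    obtain ⟨e'⟩ := hc q'.out
    have h' : c q'.out = c q.out := h.symm
    rw [h'] at e'
    rw [← q.out_eq, ← q'.out_eq]
    exact Quotient.sound ⟨e.trans e'.symm⟩
  calc numIndecomposableSummands A ((i : Fin n) → X i) ≤ ENat.card (Fin n) :=
        ENat.card_le_card_of_injective hinj
    _ = n := by simp

theorem IsTiltingModule.projective_ker (hX : IsTiltingModule A ((i : Fin n) → X i)) (i : Fin n)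
    {P : Type u} [AddCommGroup P] [Module A P] [Module.Projective A P] {p : P →ₗ[A] X i}
    (hp : Function.Surjective p) : Module.Projective A (LinearMap.ker p) := by
  have := hX.projectiveDimension_le_one
  exact projective_ker_of_hasProjectiveDimensionLE_one hp
    ((retractPi X i).hasProjectiveDimensionLT 2)

theorem IsTiltingModule.extendsFromKer (hX : IsTiltingModule A ((i : Fin n) → X i)) (i j : Fin n)
    {P : Type u} [AddCommGroup P] [Module A P] {p : P →ₗ[A] X i} (hp : Function.Surjective p) :
    ExtendsFromKer p (X j) :=
  extendsFromKer_of_subsingleton_ext hp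
    (subsingleton_ext_of_retract (retractPi X i) (retractPi X j) 1 hX.ext_one_self_eq_zero)

end Tilting

/-! ### Matching the summands of two tilting modules -/

theorem theorem4 {K : Type*} {A : Type u} [Field K] [Ring A] [Algebra K A]
    [FiniteDimensional K A] (n : ℕ)
    (X Y : Fin n → Type u)
    [∀ i, AddCommGroup (X i)] [∀ i, Module A (X i)]
    [∀ i, Module K (X i)] [∀ i, IsScalarTower K A (X i)] [∀ i, FiniteDimensional K (X i)]
    [∀ i, AddCommGroup (Y i)] [∀ i, Module A (Y i)]
    [∀ i, Module K (Y i)] [∀ i, IsScalarTower K A (Y i)] [∀ i, FiniteDimensional K (Y i)]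
    (hXindec : ∀ i, IsIndecomposableModule A (X i))
    (hYindec : ∀ i, IsIndecomposableModule A (Y i))
    (hXmult : ∀ i j, i ≠ j → IsEmpty (X i ≃ₗ[A] X j))
    (hYmult : ∀ i j, i ≠ j → IsEmpty (Y i ≃ₗ[A] Y j))
    (hXtilt : IsTiltingModule A ((i : Fin n) → X i))
    (hYtilt : IsTiltingModule A ((i : Fin n) → Y i)) :
    ∃ s : Equiv.Perm (Fin n), ∀ i,
      Nonempty (X i ≃ₗ[A] Y (s i)) ∨
        ExistsNonsplitExtension A (X i) (Y (s i)) ∨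
        ExistsNonsplitExtension A (Y (s i)) (X i) := by
  classical
  let Rel : Fin n → Fin n → Prop := fun i j => Nonempty (X i ≃ₗ[A] Y j) ∨
    ExistsNonsplitExtension A (X i) (Y j) ∨ ExistsNonsplitExtension A (Y j) (X i)
  let t : Fin n → Finset (Fin n) := fun i => Finset.univ.filter (Rel i)
  suffices hall : ∀ I : Finset (Fin n), I.card ≤ (I.biUnion t).card by
    obtain ⟨f, hf, hft⟩ := (Finset.all_card_le_biUnion_card_iff_exists_injective t).1 hall
    exact ⟨Equiv.ofBijective f (Finite.injective_iff_bijective.1 hf),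
      fun i => (Finset.mem_filter.1 (hft i)).2⟩
  intro I
  -- The `X i` with `i ∈ I` and the `Y j` outside the neighbourhood of `I` form a rigid family, which
  -- has at most `n` members.
  let J : Finset (Fin n) := (I.biUnion t)ᶜ
  have hIJ : ∀ i : I, ∀ j : J, ¬ Rel i j := fun i j h =>
    Finset.mem_compl.1 j.2
      (Finset.mem_biUnion.2 ⟨i, i.2, Finset.mem_filter.2 ⟨Finset.mem_univ _, h⟩⟩)
  let M : I ⊕ J → ModuleCat.{u} A :=
    Sum.elim (fun i => ModuleCat.of A (X i)) (fun j => ModuleCat.of A (Y j))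
  have hfin : ∀ s, Module.Finite A (M s) := by
    rintro (i | j)
    · exact (Module.Finite.of_restrictScalars_finite K A (X i) : Module.Finite A (X i))
    · exact (Module.Finite.of_restrictScalars_finite K A (Y j) : Module.Finite A (Y j))
  -- The `K`-structure through `A`, available uniformly for all members of the family.
  let inst (s) : Module K (M s) := Module.compHom _ (algebraMap K A)
  have inst' (s) : IsScalarTower K A (M s) := IsScalarTower.of_algebraMap_smul fun _ _ => rfl
  have inst'' (s) : FiniteDimensional K (M s) := Module.Finite.trans A (M s)
  choose k p hp using fun s => Module.Finite.exists_fin' A (M s)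
  have hproj : ∀ s, Module.Projective A (LinearMap.ker (p s)) := by
    rintro (i | j)
    · exact hXtilt.projective_ker i.1 (hp (.inl i))
    · exact hYtilt.projective_ker j.1 (hp (.inr j))
  have hext : ∀ s s', ExtendsFromKer (p s) (M s') := by
    rintro (i | j) (i' | j')
    · exact hXtilt.extendsFromKer i.1 i'.1 (hp (.inl i))
    · exact extendsFromKer_of_not_existsNonsplitExtension (hp (.inl i))
        fun h => hIJ i j' (Or.inr (Or.inr h))
    · exact extendsFromKer_of_not_existsNonsplitExtension (hp (.inr j))
        fun h => hIJ i' j (Or.inr (Or.inl h))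
    · exact hYtilt.extendsFromKer j.1 j'.1 (hp (.inr j))
  have hindec : ∀ s, IsIndecomposableModule A (M s) := by
    rintro (i | j)
    · exact hXindec i
    · exact hYindec j
  have hne : ∀ s s', s ≠ s' → IsEmpty (M s ≃ₗ[A] M s') := by
    rintro (i | j) (i' | j') hs
    · exact hXmult i i' fun h => hs (by rw [Subtype.ext h])
    · exact ⟨fun e => hIJ i j' (Or.inl ⟨e⟩)⟩
    · exact ⟨fun e => hIJ i' j (Or.inl ⟨e.symm⟩)⟩
    · exact hYmult j j' fun h => hs (by rw [Subtype.ext h])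
  have hcard : (Fintype.card (I ⊕ J) : ℕ∞) ≤ n := by
    calc (Fintype.card (I ⊕ J) : ℕ∞) ≤ numSimpleModules A :=
          card_le_numSimpleModules (K := K) p hp hext hindec hne
      _ = numIndecomposableSummands A ((i : Fin n) → X i) := hXtilt.card_summands_eq.symm
      _ ≤ n := numIndecomposableSummands_pi_le (K := K) hXindec
  have h1 : I.card + J.card ≤ n := by
    rw [Nat.cast_le] at hcard
    simpa using hcard
  have h2 : (I.biUnion t).card + J.card = n :=
    (Finset.card_add_card_compl (I.biUnion t)).trans (Fintype.card_fin n)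
  omega
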